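/- Let $r\ge 1$ and $n\ge 1$ be integers, let $\mathbb{Z}_n=\mathbb{Z}/n\mathbb{Z}$ and $\beta\in\mathbb{Z}_n$, and let $N_\beta$ be the number of matrices in $\mathrm{GL}_r(\mathbb{Z}_n)$ with trace $\beta$. Put $l=\gcd(n,\beta)$ (the greatest common divisor of $n$ and any integer representing $\beta$; so $l=n$ if $\beta=0$). Then $$N_\beta=n^{r^2-1}\prod_{p\mid l}\Bigl(\prod_{i=1}^r(1-p^{-i})+(-1)^r p^{-r(r+1)/2}(p-1)\Bigr)\prod_{\substack{p\mid n\\ p\nmid l}}\Bigl(\prod_{i=1}^r(1-p^{-i})-(-1)^r p^{-r(r+1)/2}\Bigr),$$ where $p$ runs over prime numbers and empty products equal $1$. -/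

import Mathlib

/-- The number `N_β` of invertible `r × r` matrices over `ℤ/nℤ` with trace `β`. -/
noncomputable def numGLTrace (r n : ℕ) (β : ZMod n) : ℕ :=
  Nat.card {X : Matrix.GeneralLinearGroup (Fin r) (ZMod n) //
    Matrix.trace (X : Matrix (Fin r) (Fin r) (ZMod n)) = β}

/-! By the Chinese remainder theorem the count is multiplicative in `n`. Reduction `ℤ/p^k → ℤ/p`
detects units, so its fibres on matrices of prescribed trace are equally large, which reduces the
problem to `𝔽_p` (`unitTraceCount_mul_of_surjective`). Over a field with `q` elements, let `D_r(β) =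
q N_r(β) - |GL_r|` measure the deviation from equidistribution. Matrices whose first column is
nonzero below the diagonal are equidistributed in trace and drop out; the others are block
triangular, which gives `D_{r+1} = -q^r D_r` (`unitTraceCount_succ`). Starting at `r = 0` and
inserting the order of `GL_r(𝔽_p)` yields the local factors. -/

open Finset Matrix

section Count
variable (R : Type*) [CommRing R] [Fintype R]

open Classical in
/-- The number of invertible `r × r` matrices over `R` with trace `β`. -/
noncomputable def unitTraceCount (r : ℕ) (β : R) : ℕ :=
  #{A : Matrix (Fin r) (Fin r) R | IsUnit A.det ∧ A.trace = β}

open Classical in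
/-- The number of invertible `r × r` matrices over `R`. -/
noncomputable def unitMatrixCount (r : ℕ) : ℕ :=
  #{A : Matrix (Fin r) (Fin r) R | IsUnit A.det}

theorem sum_unitTraceCount (r : ℕ) :
    ∑ β : R, unitTraceCount R r β = unitMatrixCount R r := by
  classical
  unfold unitMatrixCount unitTraceCount
  rw [Finset.card_eq_sum_card_fiberwise (f := fun A : Matrix (Fin r) (Fin r) R => A.trace)
    (t := univ) (by simp)]
  simp only [Finset.filter_filter]

end Count

/-! ### Finite fields: recursion on the size of the matrix -/

section Field
variable {F : Type*} [Field F]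

/-- Right multiplication by a transvection changes the trace by an arbitrary amount as soon as the
first column of the matrix has a nonzero entry below the diagonal. -/
theorem exists_unipotent_trace {r : ℕ} (c : Fin (r + 1) → F) (hc : ∃ i, i ≠ 0 ∧ c i ≠ 0) (δ : F) :
    ∃ U : Matrix (Fin (r + 1)) (Fin (r + 1)) F, U.det = 1 ∧
      ∀ A : Matrix (Fin (r + 1)) (Fin (r + 1)) F, (∀ i, A i 0 = c i) →
        (A * U).trace = A.trace + δ ∧ ∀ i, (A * U) i 0 = c i := by
  obtain ⟨i, hi, hci⟩ := hc
  refine ⟨Matrix.transvection 0 i (δ / c i), Matrix.det_transvection_of_ne _ _ hi.symm _, ?_⟩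
  intro A hA
  constructor
  · rw [Matrix.transvection, mul_add, mul_one, Matrix.trace_add, Matrix.trace_mul_single, hA]
    congr 1
    simp
    field_simp
  · intro a
    rw [Matrix.mul_transvection_apply_of_ne _ _ _ _ hi.symm, hA]

-- Multiplying by a transvection chosen from the first column shifts the trace by `γ - β`. By
-- symmetry in `β` and `γ` the inequality is an equality.
open Classical in
theorem card_trace_eq_of_column_le [Fintype F] {r : ℕ} (β γ : F) :
    #{A : Matrix (Fin (r + 1)) (Fin (r + 1)) F |
        (IsUnit A.det ∧ ∃ i, i ≠ 0 ∧ A i 0 ≠ 0) ∧ A.trace = β} ≤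
      #{A : Matrix (Fin (r + 1)) (Fin (r + 1)) F |
        (IsUnit A.det ∧ ∃ i, i ≠ 0 ∧ A i 0 ≠ 0) ∧ A.trace = γ} := by
  have key : ∀ c : Fin (r + 1) → F, ∃ U : Matrix (Fin (r + 1)) (Fin (r + 1)) F,
      (∃ i, i ≠ 0 ∧ c i ≠ 0) → U.det = 1 ∧
      ∀ A : Matrix (Fin (r + 1)) (Fin (r + 1)) F, (∀ i, A i 0 = c i) →
        (A * U).trace = A.trace + (γ - β) ∧ ∀ i, (A * U) i 0 = c i := by
    intro c
    by_cases hc : ∃ i, i ≠ 0 ∧ c i ≠ 0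
    · obtain ⟨U, hU⟩ := exists_unipotent_trace c hc (γ - β)
      exact ⟨U, fun _ => hU⟩
    · exact ⟨1, fun h => absurd h hc⟩
  choose U hU using key
  refine Finset.card_le_card_of_injOn (fun A => A * U (fun i => A i 0)) ?_ ?_
  · intro A hA
    simp only [coe_filter, mem_univ, true_and, Set.mem_ofPred_eq] at hA ⊢
    obtain ⟨⟨hdet, hcol⟩, htr⟩ := hA
    obtain ⟨h1, h2⟩ := hU (fun i => A i 0) hcol
    obtain ⟨h3, h4⟩ := h2 A fun _ => rfl
    refine ⟨⟨by rw [Matrix.det_mul, h1, mul_one]; exact hdet, ?_⟩, by rw [h3, htr]; ring⟩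
    obtain ⟨i, hi⟩ := hcol
    exact ⟨i, hi.1, by rw [h4]; exact hi.2⟩
  · intro A hA B hB hAB
    simp only [coe_filter, mem_univ, true_and, Set.mem_ofPred_eq] at hA hB hAB
    obtain ⟨h1, h2⟩ := hU (fun i => A i 0) hA.1.2
    obtain ⟨-, h2'⟩ := hU (fun i => B i 0) hB.1.2
    -- The product keeps the first column, so it determines which `U` was used.
    have hcol : (fun i => A i 0) = fun i => B i 0 := by
      funext i
      rw [← (h2 A fun _ => rfl).2 i, ← (h2' B fun _ => rfl).2 i, hAB]
    rw [← hcol] at hAB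
    have hunit : IsUnit (U fun i => A i 0) := by
      rw [Matrix.isUnit_iff_isUnit_det, h1]; exact isUnit_one
    exact hunit.mul_right_cancel hAB

/-- The matrix with first row `(c, w)`, first column `(c, 0)` and lower right block `B`. -/
def borderMatrix {r : ℕ} (c : F) (w : Fin r → F) (B : Matrix (Fin r) (Fin r) F) :
    Matrix (Fin (r + 1)) (Fin (r + 1)) F :=
  Matrix.of (Fin.cons (Fin.cons c w) fun i => Fin.cons 0 (B i))

theorem det_of_column_eq_zero {r : ℕ} (A : Matrix (Fin (r + 1)) (Fin (r + 1)) F)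
    (hA : ∀ i, i ≠ 0 → A i 0 = 0) :
    A.det = A 0 0 * (A.submatrix Fin.succ Fin.succ).det := by
  rw [Matrix.det_succ_column_zero, Finset.sum_eq_single 0]
  · simp [Fin.succAbove_zero]
  · intro i _ hi
    simp [hA i hi]
  · simp

theorem trace_succ {r : ℕ} (A : Matrix (Fin (r + 1)) (Fin (r + 1)) F) :
    A.trace = A 0 0 + (A.submatrix Fin.succ Fin.succ).trace := by
  simp [Matrix.trace, Fin.sum_univ_succ]

variable [Fintype F]

-- The corner entry is forced to be `β - tr B`, with `B` the lower right block. Invertibility means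
-- that `B` is invertible with trace other than `β`; the rest of the top row is free.
open Classical in
theorem card_trace_eq_of_column_eq_zero {r : ℕ} (β : F) :
    #{A : Matrix (Fin (r + 1)) (Fin (r + 1)) F |
        (IsUnit A.det ∧ ¬ ∃ i, i ≠ 0 ∧ A i 0 ≠ 0) ∧ A.trace = β} +
      Fintype.card F ^ r * unitTraceCount F r β = Fintype.card F ^ r * unitMatrixCount F r := by
  have h1 : unitMatrixCount F r = #{B : Matrix (Fin r) (Fin r) F | IsUnit B.det ∧ B.trace ≠ β} +
      unitTraceCount F r β := by
    unfold unitMatrixCount unitTraceCount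
    rw [add_comm, ← Finset.card_filter_add_card_filter_not (p := fun B => B.trace = β)]
    simp only [Finset.filter_filter, ne_eq]
  rw [h1, mul_add]
  congr 1
  have h2 : Fintype.card F ^ r = #(univ : Finset (Fin r → F)) := by simp
  rw [h2, ← Finset.card_product]
  refine Finset.card_bij' (fun A _ => (fun j => A 0 j.succ, A.submatrix Fin.succ Fin.succ))
    (fun x _ => borderMatrix (β - x.2.trace) x.1 x.2) ?_ ?_ ?_ ?_
  · intro A hA
    simp only [mem_filter, mem_univ, true_and, mem_product] at hA ⊢
    obtain ⟨⟨hd, hc⟩, ht⟩ := hA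
    push Not at hc
    rw [det_of_column_eq_zero A hc, IsUnit.mul_iff] at hd
    rw [trace_succ] at ht
    refine ⟨hd.2, fun h => hd.1.ne_zero ?_⟩
    rw [h] at ht
    simpa using ht
  · rintro ⟨w, B⟩ hB
    simp only [mem_filter, mem_univ, true_and, mem_product] at hB ⊢
    have hc : ∀ i, i ≠ 0 → borderMatrix (β - B.trace) w B i 0 = 0 := by
      intro i hi
      obtain ⟨j, rfl⟩ := Fin.exists_succ_eq.mpr hi
      simp [borderMatrix]
    have hs : (borderMatrix (β - B.trace) w B).submatrix Fin.succ Fin.succ = B := by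
      ext i j; simp [borderMatrix]
    have h0 : borderMatrix (β - B.trace) w B 0 0 = β - B.trace := by simp [borderMatrix]
    refine ⟨⟨?_, by push Not; exact hc⟩, ?_⟩
    · rw [det_of_column_eq_zero _ hc, hs, h0, IsUnit.mul_iff]
      exact ⟨(sub_ne_zero.mpr hB.2.symm).isUnit, hB.1⟩
    · rw [trace_succ, hs, h0]; ring
  · intro A hA
    simp only [mem_filter, mem_univ, true_and] at hA
    obtain ⟨⟨hd, hc⟩, ht⟩ := hA
    push Not at hc
    rw [trace_succ] at ht
    ext i j
    refine Fin.cases ?_ (fun i => ?_) i <;> refine Fin.cases ?_ (fun j => ?_) j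
    · simp [borderMatrix, ← ht]
    · simp [borderMatrix]
    · simp [borderMatrix, hc]
    · simp [borderMatrix]
  · rintro ⟨w, B⟩ hB
    ext <;> simp [borderMatrix]

theorem unitTraceCount_succ (r : ℕ) (β : F) :
    (Fintype.card F : ℤ) * unitTraceCount F (r + 1) β - unitMatrixCount F (r + 1) =
      -(Fintype.card F : ℤ) ^ r *
        (Fintype.card F * unitTraceCount F r β - unitMatrixCount F r) := by
  classical
  set Q : F → ℕ := fun β => #{A : Matrix (Fin (r + 1)) (Fin (r + 1)) F |
        (IsUnit A.det ∧ ∃ i, i ≠ 0 ∧ A i 0 ≠ 0) ∧ A.trace = β} with hQ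
  set P : F → ℕ := fun β => #{A : Matrix (Fin (r + 1)) (Fin (r + 1)) F |
        (IsUnit A.det ∧ ¬ ∃ i, i ≠ 0 ∧ A i 0 ≠ 0) ∧ A.trace = β} with hP
  have hsplit : ∀ β, unitTraceCount F (r + 1) β = Q β + P β := by
    intro β
    simp only [hQ, hP, unitTraceCount]
    rw [← Finset.card_filter_add_card_filter_not
      (p := fun A : Matrix (Fin (r + 1)) (Fin (r + 1)) F => ∃ i, i ≠ 0 ∧ A i 0 ≠ 0)]
    simp only [Finset.filter_filter, and_right_comm]
  have hQc : ∀ γ, Q γ = Q β := fun γ =>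
    le_antisymm (card_trace_eq_of_column_le _ _) (card_trace_eq_of_column_le _ _)
  have hPc : ∀ γ, (P γ : ℤ) = (Fintype.card F : ℤ) ^ r * unitMatrixCount F r -
      (Fintype.card F : ℤ) ^ r * unitTraceCount F r γ := by
    intro γ
    rw [eq_sub_iff_add_eq]
    exact_mod_cast card_trace_eq_of_column_eq_zero γ
  have hG : (unitMatrixCount F (r + 1) : ℤ) = Fintype.card F * Q β +
      (Fintype.card F * ((Fintype.card F : ℤ) ^ r * unitMatrixCount F r) -
        (Fintype.card F : ℤ) ^ r * unitMatrixCount F r) := by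
    rw [← sum_unitTraceCount, ← sum_unitTraceCount F r]
    push_cast
    simp only [hsplit, hQc, Nat.cast_add, Finset.sum_add_distrib, hPc, Finset.sum_sub_distrib,
      ← Finset.mul_sum]
    simp [← sum_unitTraceCount F r, mul_left_comm]
  rw [hG, hsplit]
  push_cast
  rw [hPc]
  ring

theorem card_mul_unitTraceCount [DecidableEq F] (r : ℕ) (β : F) :
    (Fintype.card F : ℤ) * unitTraceCount F r β - unitMatrixCount F r =
      (-1) ^ r * (Fintype.card F : ℤ) ^ (r * (r - 1) / 2) *
        (if β = 0 then (Fintype.card F : ℤ) - 1 else -1) := by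
  induction r with
  | zero =>
    have hcard : Fintype.card (Matrix (Fin 0) (Fin 0) F) = 1 :=
      Fintype.card_eq_one_iff.mpr ⟨0, fun _ => Subsingleton.elim _ _⟩
    have h : unitMatrixCount F 0 = 1 := by
      simp [unitMatrixCount, hcard]
    have h' : unitTraceCount F 0 β = if β = 0 then 1 else 0 := by
      simp only [unitTraceCount, Matrix.trace_fin_zero, Matrix.det_isEmpty, isUnit_one, true_and,
        eq_comm (a := (0 : F))]
      split_ifs with hβ <;> simp [hβ, hcard]
    rw [h, h']
    split_ifs <;> simp
  | succ r ih =>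
    rw [unitTraceCount_succ, ih]
    have : (r + 1) * (r + 1 - 1) / 2 = r + r * (r - 1) / 2 := by
      rw [← Finset.sum_range_id_mul_two, ← Finset.sum_range_id_mul_two, Finset.sum_range_succ]
      omega
    rw [this, pow_add, pow_succ]
    ring

theorem card_GL_eq_unitMatrixCount (R : Type*) [CommRing R] [Fintype R] (r : ℕ) :
    Nat.card (Matrix.GeneralLinearGroup (Fin r) R) = unitMatrixCount R r := by
  classical
  rw [unitMatrixCount, ← Fintype.card_subtype, ← Nat.card_eq_fintype_card]
  refine Nat.card_congr (Equiv.ofBijective (fun X => ⟨X.1, ?_⟩) ⟨?_, ?_⟩)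
  · exact (Matrix.isUnit_iff_isUnit_det _).mp X.isUnit
  · intro X Y h
    exact Units.ext (congrArg Subtype.val h)
  · rintro ⟨A, hA⟩
    obtain ⟨u, hu⟩ := (Matrix.isUnit_iff_isUnit_det _).mpr hA
    exact ⟨u, Subtype.ext hu⟩

end Field

/-! ### Transfer along ring homomorphisms -/

section Ring

/-- All fibres are cosets of the kernel, hence of equal size. -/
theorem card_filter_comp_mul_card {G H : Type*} [AddGroup G] [AddGroup H] [Fintype G] [Fintype H]
    (f : G →+ H) (hf : Function.Surjective f) (p : H → Prop) [DecidablePred p] :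
    #{g | p (f g)} * Fintype.card H = #{y | p y} * Fintype.card G := by
  classical
  have hc : ∀ y, #{g | f g = y} = #{g | f g = 0} := fun y =>
    AddMonoidHom.card_fiber_eq_of_mem_range f (hf y) (hf 0)
  have h : ∀ q : H → Prop, ∀ [DecidablePred q], #{g | q (f g)} = #{y | q y} * #{g | f g = 0} := by
    intro q _
    rw [Finset.card_eq_sum_card_fiberwise (f := f) (t := ({y | q y} : Finset H)) (by
      intro g; simp)]
    rw [Finset.sum_congr rfl (g := fun _ => #{g | f g = 0}), Finset.sum_const, smul_eq_mul]
    intro y hy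
    rw [← hc y, Finset.filter_filter]
    congr 1
    ext g
    simp only [mem_filter, mem_univ, true_and] at hy ⊢
    exact ⟨fun h => h.2, fun h => ⟨by rw [h]; exact hy, h⟩⟩
  have h' := h fun _ => True
  simp only [Finset.filter_true, Finset.card_univ] at h'
  rw [h p, h']
  ring

variable {R S : Type*} [CommRing R] [CommRing S] [Fintype R] [Fintype S]

theorem card_trace_ker_mul_card [DecidableEq R] (r : ℕ) :
    Fintype.card (Matrix.traceAddMonoidHom (Fin (r + 1)) R).ker * Fintype.card R =
      Fintype.card R ^ (r + 1) ^ 2 := by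
  have hsurj : Function.Surjective (Matrix.traceAddMonoidHom (Fin (r + 1)) R) := fun x =>
    ⟨Matrix.single 0 0 x, by simp [Matrix.traceAddMonoidHom_apply]⟩
  have h := card_filter_comp_mul_card _ hsurj (fun x => x = 0)
  have hM : Fintype.card (Matrix (Fin (r + 1)) (Fin (r + 1)) R) =
      Fintype.card R ^ (r + 1) ^ 2 := by
    rw [← Nat.card_eq_fintype_card, ← Nat.card_eq_fintype_card]
    simp [Matrix, ← pow_mul, sq]
  rw [hM] at h
  simp only [Finset.filter_eq', Finset.mem_univ, if_true, Finset.card_singleton, one_mul] at h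
  rw [← h, ← Fintype.card_subtype]
  congr 1
  exact Fintype.card_congr (Equiv.refl _)

theorem card_trace_ker [DecidableEq R] (r : ℕ) :
    Fintype.card (Matrix.traceAddMonoidHom (Fin (r + 1)) R).ker =
      Fintype.card R ^ ((r + 1) ^ 2 - 1) := by
  have h := card_trace_ker_mul_card (R := R) r
  have h2 : (r + 1) ^ 2 = (r + 1) ^ 2 - 1 + 1 :=
    (Nat.succ_pred_eq_of_pos (by positivity)).symm
  rw [h2, pow_succ] at h
  exact Nat.eq_of_mul_eq_mul_right Fintype.card_pos h

-- Translating by a corner matrix replaces the trace condition by membership in an additive group,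
-- where fibres of a homomorphism can be counted.
open Classical in
theorem unitTraceCount_eq_card_ker {r : ℕ} (β : R) :
    unitTraceCount R (r + 1) β =
      #{C : (Matrix.traceAddMonoidHom (Fin (r + 1)) R).ker |
        IsUnit (C.1 + Matrix.single 0 0 β).det} := by
  symm
  refine Finset.card_bij (fun C _ => C.1 + Matrix.single 0 0 β) ?_ ?_ ?_
  · rintro ⟨C, hC⟩ h
    have hC' : C.trace = 0 := hC
    simpa [Matrix.trace_add, hC'] using h
  · intro C _ D _ h
    exact Subtype.ext (add_right_cancel h)
  · intro A hA
    simp only [mem_filter, mem_univ, true_and] at hA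
    refine ⟨⟨A - Matrix.single 0 0 β, ?_⟩, ?_, ?_⟩
    · change (A - Matrix.single 0 0 β).trace = 0
      simp [Matrix.trace_sub, hA.2]
    · simpa using hA.1
    · simp

/-- A surjective local homomorphism has equidistributed fibres on invertible matrices with
prescribed trace. -/
theorem unitTraceCount_mul_of_surjective (φ : R →+* S) (hφ : Function.Surjective φ) [IsLocalHom φ]
    (r : ℕ) (β : R) :
    unitTraceCount R (r + 1) β * Fintype.card S ^ ((r + 1) ^ 2 - 1) =
      unitTraceCount S (r + 1) (φ β) * Fintype.card R ^ ((r + 1) ^ 2 - 1) := by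
  classical
  have htr : ∀ A : Matrix (Fin (r + 1)) (Fin (r + 1)) R,
      (φ.mapMatrix A).trace = φ A.trace := fun A => (AddMonoidHom.map_trace φ.toAddMonoidHom A).symm
  let f : (Matrix.traceAddMonoidHom (Fin (r + 1)) R).ker →+
      (Matrix.traceAddMonoidHom (Fin (r + 1)) S).ker :=
    (φ.mapMatrix.toAddMonoidHom.comp (AddSubgroup.subtype _)).codRestrict _ (by
      rintro ⟨A, hA⟩
      have hA' : A.trace = 0 := hA
      change (φ.mapMatrix A).trace = 0
      rw [htr, hA', map_zero])
  have hf : Function.Surjective f := by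
    rintro ⟨B, hB⟩
    have hB' : B.trace = 0 := hB
    choose g hg using hφ
    let A : Matrix (Fin (r + 1)) (Fin (r + 1)) R := B.map g
    have hA : φ.mapMatrix A = B := by ext i j; simp [A, hg]
    have hk : φ A.trace = 0 := by rw [← htr, hA, hB']
    -- The trace of the entrywise lift lies in the kernel of `φ`, so removing it at the corner
    -- leaves the image unchanged.
    refine ⟨⟨A - Matrix.single 0 0 A.trace, ?_⟩, Subtype.ext ?_⟩
    · change (A - Matrix.single 0 0 A.trace).trace = 0
      simp [Matrix.trace_sub]
    · change φ.mapMatrix (A - Matrix.single 0 0 A.trace) = B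
      rw [map_sub, hA]
      ext i j
      simp [Matrix.single_apply]
      intros; exact hk
  have h := card_filter_comp_mul_card f hf
    (fun C => IsUnit (C.1 + Matrix.single 0 0 (φ β)).det)
  rw [card_trace_ker, card_trace_ker] at h
  rw [unitTraceCount_eq_card_ker (φ β), ← h]
  congr 1
  rw [unitTraceCount_eq_card_ker]
  congr 1
  ext C
  simp only [mem_filter, mem_univ, true_and]
  have : (f C).1 + Matrix.single 0 0 (φ β) = φ.mapMatrix (C.1 + Matrix.single 0 0 β) := by
    change φ.mapMatrix C.1 + _ = _
    rw [map_add]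
    congr 1
    ext i j
    simp [Matrix.single_apply, apply_ite φ]
  rw [this, ← RingHom.map_det, isUnit_map_iff]

theorem unitTraceCount_congr (e : R ≃+* S) (r : ℕ) (β : R) :
    unitTraceCount R r β = unitTraceCount S r (e β) := by
  classical
  have htr : ∀ A : Matrix (Fin r) (Fin r) R, (e.mapMatrix A).trace = e A.trace := fun A =>
    (AddMonoidHom.map_trace e.toAddMonoidHom A).symm
  refine Finset.card_equiv e.mapMatrix.toEquiv fun A => ?_
  have : e.mapMatrix.toEquiv A = e.mapMatrix A := rfl
  simp only [mem_filter, mem_univ, true_and, this]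
  rw [htr, ← RingEquiv.map_det, e.injective.eq_iff, MulEquiv.isUnit_map]

theorem unitTraceCount_prod (r : ℕ) (β : R) (γ : S) :
    unitTraceCount (R × S) r (β, γ) = unitTraceCount R r β * unitTraceCount S r γ := by
  classical
  unfold unitTraceCount
  rw [← Finset.card_product]
  have h1 : ∀ A : Matrix (Fin r) (Fin r) (R × S), ((RingHom.fst R S).mapMatrix A).trace =
    A.trace.1 := fun A => (AddMonoidHom.map_trace (AddMonoidHom.fst R S) A).symm
  have h2 : ∀ A : Matrix (Fin r) (Fin r) (R × S), ((RingHom.snd R S).mapMatrix A).trace =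
    A.trace.2 := fun A => (AddMonoidHom.map_trace (AddMonoidHom.snd R S) A).symm
  have h3 : ∀ A : Matrix (Fin r) (Fin r) (R × S), ((RingHom.fst R S).mapMatrix A).det =
    A.det.1 := fun A => ((RingHom.fst R S).map_det A).symm
  have h4 : ∀ A : Matrix (Fin r) (Fin r) (R × S), ((RingHom.snd R S).mapMatrix A).det =
    A.det.2 := fun A => ((RingHom.snd R S).map_det A).symm
  let e : Matrix (Fin r) (Fin r) (R × S) ≃ Matrix (Fin r) (Fin r) R × Matrix (Fin r) (Fin r) S :=
    { toFun A := ((RingHom.fst R S).mapMatrix A, (RingHom.snd R S).mapMatrix A)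
      invFun B := Matrix.of fun i j => (B.1 i j, B.2 i j)
      left_inv A := rfl
      right_inv B := rfl }
  refine Finset.card_equiv e fun A => ?_
  have : e A = ((RingHom.fst R S).mapMatrix A, (RingHom.snd R S).mapMatrix A) := rfl
  simp only [mem_filter, mem_univ, true_and, mem_product, this, h1, h2, h3, h4, Prod.isUnit_iff,
    Prod.ext_iff]
  tauto

end Ring

/-! ### Counting over `ℤ/nℤ` -/

theorem numGLTrace_eq_unitTraceCount (r n : ℕ) [NeZero n] (β : ZMod n) :
    numGLTrace r n β = unitTraceCount (ZMod n) r β := by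
  classical
  rw [numGLTrace, unitTraceCount, ← Fintype.card_subtype, ← Nat.card_eq_fintype_card]
  refine Nat.card_congr (Equiv.ofBijective
    (fun X => ⟨X.1.1, (Matrix.isUnit_iff_isUnit_det _).mp X.1.isUnit, X.2⟩) ⟨?_, ?_⟩)
  · intro X Y h
    exact Subtype.ext (Units.ext (congrArg Subtype.val h))
  · rintro ⟨A, hA, ht⟩
    obtain ⟨u, rfl⟩ := (Matrix.isUnit_iff_isUnit_det _).mpr hA
    exact ⟨⟨u, ht⟩, rfl⟩

theorem unitTraceCount_zmod_mul (r m n : ℕ) [NeZero m] [NeZero n] (h : m.Coprime n) (b : ℕ) :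
    unitTraceCount (ZMod (m * n)) r b =
      unitTraceCount (ZMod m) r b * unitTraceCount (ZMod n) r b := by
  rw [unitTraceCount_congr (ZMod.chineseRemainder h), map_natCast, ← unitTraceCount_prod]
  rfl

theorem isLocalHom_castHom_prime_pow (p k : ℕ) [Fact p.Prime] (hk : k ≠ 0) :
    IsLocalHom (ZMod.castHom (dvd_pow_self p hk) (ZMod p)) := by
  have : NeZero (p ^ k) := ⟨pow_ne_zero _ (Fact.out : p.Prime).ne_zero⟩
  refine ⟨fun a ha => ?_⟩
  obtain ⟨b, rfl⟩ := ZMod.natCast_zmod_surjective a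
  rw [map_natCast, ZMod.isUnit_iff_coprime] at ha
  rw [ZMod.isUnit_iff_coprime]
  exact ha.pow_right k

theorem unitTraceCount_zmod_prime_pow (r p k : ℕ) [Fact p.Prime] (hr : r ≠ 0) (hk : k ≠ 0)
    (b : ℕ) [NeZero (p ^ k)] :
    unitTraceCount (ZMod (p ^ k)) r b * p ^ (r ^ 2 - 1) =
      unitTraceCount (ZMod p) r b * (p ^ k) ^ (r ^ 2 - 1) := by
  obtain ⟨s, rfl⟩ := Nat.exists_eq_add_one_of_ne_zero hr
  have := isLocalHom_castHom_prime_pow p k hk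
  have h := unitTraceCount_mul_of_surjective (ZMod.castHom (dvd_pow_self p hk) (ZMod p))
    (ZMod.ringHom_surjective _) s b
  rwa [map_natCast, ZMod.card, ZMod.card] at h

theorem unitMatrixCount_zmod_prime (r p : ℕ) [Fact p.Prime] :
    (unitMatrixCount (ZMod p) r : ℚ) =
      (p : ℚ) ^ r ^ 2 * ∏ i ∈ Finset.Icc 1 r, (1 - (p : ℚ) ^ (-(i : ℤ))) := by
  have hp : (p : ℚ) ≠ 0 := Nat.cast_ne_zero.mpr (Fact.out : p.Prime).ne_zero
  rw [← card_GL_eq_unitMatrixCount, Matrix.card_GL_field, ZMod.card,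
    Fin.prod_univ_eq_prod_range (fun i => p ^ r - p ^ i) r, Nat.cast_prod,
    ← Finset.prod_range_reflect, ← Finset.Ico_add_one_right_eq_Icc,
    Finset.prod_Ico_eq_prod_range, sq, pow_mul]
  simp only [Nat.add_sub_cancel]
  have hc : ((p : ℚ) ^ r) ^ r = ∏ _j ∈ Finset.range r, (p : ℚ) ^ r := by
    rw [Finset.prod_const, Finset.card_range]
  rw [hc, ← Finset.prod_mul_distrib]
  refine Finset.prod_congr rfl fun j hj => ?_
  rw [Finset.mem_range] at hj
  have hle : p ^ (r - 1 - j) ≤ p ^ r :=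
    Nat.pow_le_pow_right (Fact.out : p.Prime).pos (by omega)
  rw [Nat.cast_sub hle]
  push_cast
  rw [mul_sub, mul_one, ← zpow_natCast (p : ℚ) r, ← zpow_add₀ hp, ← zpow_natCast]
  congr 2
  omega

/-- The factor at `p` of the number of invertible matrices with trace `b`. -/
noncomputable def localFactor (r p b : ℕ) : ℚ :=
  if p ∣ b then
    ∏ i ∈ Finset.Icc 1 r, (1 - (p : ℚ) ^ (-(i : ℤ))) +
      (-1) ^ r * (p : ℚ) ^ (-((r * (r + 1) / 2 : ℕ) : ℤ)) * ((p : ℚ) - 1)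
  else
    ∏ i ∈ Finset.Icc 1 r, (1 - (p : ℚ) ^ (-(i : ℤ))) -
      (-1) ^ r * (p : ℚ) ^ (-((r * (r + 1) / 2 : ℕ) : ℤ))

theorem unitTraceCount_zmod_prime (r p b : ℕ) [Fact p.Prime] (hr : r ≠ 0) :
    (unitTraceCount (ZMod p) r b : ℚ) = (p : ℚ) ^ (r ^ 2 - 1) * localFactor r p b := by
  have hp : (p : ℚ) ≠ 0 := Nat.cast_ne_zero.mpr (Fact.out : p.Prime).ne_zero
  have h := congrArg (Int.cast (R := ℚ)) (card_mul_unitTraceCount r (b : ZMod p))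
  push_cast at h
  rw [ZMod.card, unitMatrixCount_zmod_prime, sub_eq_iff_eq_add] at h
  have hexp : (p : ℚ) ^ (r * (r - 1) / 2) =
      (p : ℚ) ^ r ^ 2 * (p : ℚ) ^ (-((r * (r + 1) / 2 : ℕ) : ℤ)) := by
    rw [← zpow_natCast, ← zpow_natCast, ← zpow_add₀ hp]
    congr 1
    -- Both products are even, so the truncated divisions are exact.
    have h1 : r ^ 2 = r * (r - 1) / 2 + r * (r + 1) / 2 := by
      have e1 : r * (r - 1) / 2 * 2 = r * (r - 1) :=
        Nat.div_mul_cancel (Nat.even_mul_pred_self r).two_dvd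
      have e2 : r * (r + 1) / 2 * 2 = r * (r + 1) :=
        Nat.div_mul_cancel (Nat.even_mul_succ_self r).two_dvd
      obtain ⟨s, rfl⟩ := Nat.exists_eq_succ_of_ne_zero hr
      simp only [Nat.succ_eq_add_one, Nat.add_sub_cancel] at *
      nlinarith
    rw [h1]
    push_cast
    ring
  have hpow : (p : ℚ) ^ r ^ 2 = p * (p : ℚ) ^ (r ^ 2 - 1) := by
    rw [← pow_succ', Nat.sub_add_cancel (Nat.one_le_pow _ _ (Nat.pos_of_ne_zero hr))]
  apply mul_left_cancel₀ hp
  rw [h, hexp, ← mul_assoc (p : ℚ), ← hpow, localFactor]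
  simp only [ZMod.natCast_eq_zero_iff]
  split_ifs <;> push_cast <;> ring

theorem unitTraceCount_zmod (r n b : ℕ) [hn : NeZero n] (hr : r ≠ 0) :
    (unitTraceCount (ZMod n) r b : ℚ) =
      (n : ℚ) ^ (r ^ 2 - 1) * ∏ p ∈ n.primeFactors, localFactor r p b := by
  revert hn
  induction n using Nat.recOnPosPrimePosCoprime with
  | prime_pow p k hp hk =>
    intro _
    have : Fact p.Prime := ⟨hp⟩
    have hp0 : (p : ℚ) ^ (r ^ 2 - 1) ≠ 0 := pow_ne_zero _ (Nat.cast_ne_zero.mpr hp.ne_zero)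
    have h := congrArg (Nat.cast (R := ℚ)) (unitTraceCount_zmod_prime_pow r p k hr hk.ne' b)
    push_cast at h
    rw [unitTraceCount_zmod_prime r p b hr] at h
    rw [Nat.primeFactors_prime_pow hk.ne' hp, Finset.prod_singleton]
    apply mul_right_cancel₀ hp0
    push_cast
    rw [h]
    ring
  | zero =>
    intro hn
    exact absurd rfl hn.out
  | one =>
    intro _
    have h : unitTraceCount (ZMod 1) r b = 1 := by
      have : Subsingleton (ZMod 1) := inferInstanceAs (Subsingleton (Fin 1))
      rw [unitTraceCount, Finset.card_eq_one]
      refine ⟨0, ?_⟩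
      ext A
      simp only [mem_filter, mem_univ, true_and, mem_singleton]
      exact ⟨fun _ => Subsingleton.elim _ _,
        fun _ => ⟨isUnit_of_subsingleton _, Subsingleton.elim _ _⟩⟩
    simp [h]
  | coprime m n hm hn hmn ihm ihn =>
    intro _
    have : NeZero m := ⟨by omega⟩
    have : NeZero n := ⟨by omega⟩
    have h := unitTraceCount_zmod_mul r m n hmn b
    rw [hmn.primeFactors_mul, Finset.prod_union hmn.disjoint_primeFactors]
    have h' : (unitTraceCount (ZMod (m * n)) r b : ℚ) =
      unitTraceCount (ZMod m) r b * unitTraceCount (ZMod n) r b := by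
      rw [← Nat.cast_mul, ← h]
    rw [h', ihm, ihn]
    push_cast
    ring

theorem theorem8 (r n : ℕ) (hr : 1 ≤ r) (hn : 1 ≤ n) (β : ZMod n)
    (l : ℕ) (hl : l = Nat.gcd n β.val) :
    (numGLTrace r n β : ℚ) =
      (n : ℚ) ^ ((r : ℤ) ^ 2 - 1) *
        (∏ p ∈ l.primeFactors,
          (∏ i ∈ Finset.Icc 1 r, (1 - (p : ℚ) ^ (-(i : ℤ))) +
            (-1) ^ r * (p : ℚ) ^ (-((r * (r + 1) / 2 : ℕ) : ℤ)) * ((p : ℚ) - 1))) *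
        (∏ p ∈ n.primeFactors with ¬ p ∣ l,
          (∏ i ∈ Finset.Icc 1 r, (1 - (p : ℚ) ^ (-(i : ℤ))) -
            (-1) ^ r * (p : ℚ) ^ (-((r * (r + 1) / 2 : ℕ) : ℤ)))) := by
  have : NeZero n := ⟨by omega⟩
  have hdvd : ∀ p ∈ n.primeFactors, (p ∣ l ↔ p ∣ β.val) := fun p hp => by
    rw [hl, Nat.dvd_gcd_iff, and_iff_right (Nat.dvd_of_mem_primeFactors hp)]
  have hprimes : l.primeFactors = {p ∈ n.primeFactors | p ∣ l} := by
    have hl0 : l ≠ 0 := hl ▸ (Nat.gcd_pos_of_pos_left _ hn).ne'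
    have hln : l ∣ n := hl ▸ Nat.gcd_dvd_left _ _
    ext p
    simp only [Nat.mem_primeFactors, Finset.mem_filter]
    exact ⟨fun h => ⟨⟨h.1, h.2.1.trans hln, this.out⟩, h.2.1⟩, fun h => ⟨h.1.1, h.2, hl0⟩⟩
  have hexp : (r : ℤ) ^ 2 - 1 = ((r ^ 2 - 1 : ℕ) : ℤ) := by
    rw [Nat.cast_sub (Nat.one_le_pow _ _ hr)]
    push_cast
    rfl
  have h := unitTraceCount_zmod r n β.val (by omega)
  rw [ZMod.natCast_zmod_val] at h
  rw [numGLTrace_eq_unitTraceCount, h, hexp, zpow_natCast, mul_assoc, hprimes,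
    ← Finset.prod_filter_mul_prod_filter_not n.primeFactors (fun p => p ∣ l)]
  congr 2 <;> refine Finset.prod_congr rfl fun p hp => ?_ <;>
    rw [Finset.mem_filter] at hp <;> rw [localFactor]
  · rw [if_pos ((hdvd p hp.1).mp hp.2)]
  · rw [if_neg (fun h => hp.2 ((hdvd p hp.1).mpr h))]
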